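/- Let $n\ge 1$, let $\Omega\subset\mathbb R^n$ be a bounded convex domain (open set) with $0\in\partial\Omega$, let $0<\lambda<\infty$, and let $\varphi\in C(\partial\Omega)$ satisfy $\varphi\ge 0$ on $\partial\Omega$. Let $u\in C(\overline\Omega)$ be a nonnegative generalized (Alexandrov) solution of $$\det\nabla^2u\ \ge\ \lambda\quad\text{in }\Omega,\qquad u=\varphi\quad\text{on }\partial\Omega,$$ that is, $u$ is locally convex in $\Omega$ and $|\partial u(E)|\ge\lambda|E|$ for every Borel set $E\subset\Omega$, where $|\cdot|$ is Lebesgue measure, $\partial u(E)=\bigcup_{x\in E}\partial u(x)$ and $\partial u(x)=\{p\in\mathbb R^n : u(y)\ge u(x)+p\cdot(y-x)\ \text{for all }y\in\Omega\}$. Suppose that there are $c>0$ and $\beta>1-\frac2n$ such that $\varphi(x)\le c|x|^{1+\beta}$ for all $x\in\partial\Omega$ sufficiently close to $0$. Then $u>0$ in $\Omega$. -/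

import Mathlib

open MeasureTheory
open scoped Topology

namespace MongeAmpere

/-- `u` is locally convex in `Ω`: every point of `Ω` is the centre of a ball contained in `Ω`
on which `u` is convex. -/
def LocallyConvexOn {n : ℕ} (Ω : Set (EuclideanSpace ℝ (Fin n)))
    (u : EuclideanSpace ℝ (Fin n) → ℝ) : Prop :=
  ∀ x ∈ Ω, ∃ r > 0, Metric.ball x r ⊆ Ω ∧ ConvexOn ℝ (Metric.ball x r) u

/-- The set `∂u(x)` of subgradients of `u : Ω → ℝ` at `x` (the normal mapping). -/
def subgradients {n : ℕ} (Ω : Set (EuclideanSpace ℝ (Fin n)))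
    (u : EuclideanSpace ℝ (Fin n) → ℝ) (x : EuclideanSpace ℝ (Fin n)) :
    Set (EuclideanSpace ℝ (Fin n)) :=
  {p | ∀ y ∈ Ω, u x + inner ℝ p (y - x) ≤ u y}

/-- The Monge-Ampère measure of `u : Ω → ℝ`, `E ↦ |∂u(E)|`, where `∂u(E)` is the union of the
`∂u(x)` over `x ∈ E` and `|·|` is Lebesgue measure. -/
noncomputable def mongeAmpereMeasure {n : ℕ} (Ω : Set (EuclideanSpace ℝ (Fin n)))
    (u : EuclideanSpace ℝ (Fin n) → ℝ) (E : Set (EuclideanSpace ℝ (Fin n))) : ENNReal :=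
  volume (⋃ x ∈ E, subgradients Ω u x)

/-- `u` is a generalized (Alexandrov) solution of `det ∇²u ≥ lam` in the convex domain `Ω`:
it is locally convex in `Ω` and its Monge-Ampère measure is at least `lam` times Lebesgue
measure on the Borel subsets of `Ω`. -/
def IsGeneralizedSolutionGE {n : ℕ} (Ω : Set (EuclideanSpace ℝ (Fin n))) (lam : ℝ)
    (u : EuclideanSpace ℝ (Fin n) → ℝ) : Prop :=
  LocallyConvexOn Ω u ∧
    ∀ E ⊆ Ω, MeasurableSet E → ENNReal.ofReal lam * volume E ≤ mongeAmpereMeasure Ω u E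

end MongeAmpere

namespace MongeAmpere

variable {E : Type*} [NormedAddCommGroup E] [InnerProductSpace ℝ E]

/-! Suppose u(x₀) = 0 with x₀ in Ω. Let E be a box of width about h around the middle half of [0,
x₀], and let p be a subgradient at a point of E. As u ≥ 0 on E while u ≤ 0 at both ends of the
segment, |p·x₀| ≲ |p|h. In every direction there are boundary points at distance O(h) from 0, up to
a shift along x₀, where u ≤ ε ~ h^(1+β). Testing p there gives |p| ≤ ε/h and |p·x₀| ≲ ε
(`norm_le_and_abs_inner_le`). So |∂u(E)| ≲ ε(ε/h)^(n-1) while |E| ~ h^(n-1), whence h^(2(n-1)) ≲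
h^(n(1+β)) (`exists_pow_le_of_eq_zero`). Letting h → 0 gives β ≤ 1 - 2/n, a contradiction. -/

/-- If `0` is in the closure of the convex open set `Ω`, the dilations of a ball in `Ω` by factors
in `(0, 1]` stay in `Ω`. -/
theorem smul_add_mem_of_ball_subset {Ω : Set E} (hΩ : IsOpen Ω) (hconv : Convex ℝ Ω)
    (h0 : (0 : E) ∈ closure Ω) {x₀ w : E} {r s : ℝ} (hball : Metric.ball x₀ r ⊆ Ω)
    (hs : 0 < s) (hs1 : s ≤ 1) (hw : ‖w‖ < s * r) : s • x₀ + w ∈ Ω := by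
  have h1 : x₀ + s⁻¹ • w ∈ interior Ω := by
    rw [hΩ.interior_eq]
    apply hball
    rw [mem_ball_iff_norm, add_sub_cancel_left, norm_smul, norm_inv, Real.norm_of_nonneg hs.le,
      inv_mul_lt_iff₀ hs]
    exact hw
  have h2 := hconv.combo_interior_closure_mem_interior h1 h0 hs (sub_nonneg.2 hs1) (by ring)
  rwa [hΩ.interior_eq, smul_zero, add_zero, smul_add, smul_inv_smul₀ hs.ne'] at h2

/-- Near a boundary point `0` of a convex open set, the boundary is reached from any point `v`
by a displacement of size `O(‖v‖)` along a direction pointing to the inside. -/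
theorem exists_add_smul_mem_frontier {Ω : Set E} (hΩ : IsOpen Ω) (hconv : Convex ℝ Ω)
    (h0 : (0 : E) ∈ frontier Ω) {x₀ v : E} {r ρ : ℝ} (hball : Metric.ball x₀ r ⊆ Ω)
    (hr : 0 < r) (hρ : 0 < ρ) (hρr : 2 * ρ ≤ r) (hv : ‖v‖ ≤ ρ) :
    ∃ θ : ℝ, |θ| ≤ 2 * ρ / r ∧ v + θ • x₀ ∈ frontier Ω := by
  have h0c : (0 : E) ∈ closure Ω := frontier_subset_closure h0
  have h0n : (0 : E) ∉ Ω := fun h => by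
    rw [hΩ.frontier_eq] at h0
    exact h0.2 h
  set s := 2 * ρ / r with hs_def
  have hs : 0 < s := by positivity
  have hs1 : s ≤ 1 := (div_le_one hr).2 hρr
  have hsr : s * r = 2 * ρ := div_mul_cancel₀ _ hr.ne'
  have hin : v + s • x₀ ∈ Ω := by
    rw [add_comm]
    exact smul_add_mem_of_ball_subset hΩ hconv h0c hball hs hs1 (by linarith)
  -- Otherwise 0 would be a convex combination of v - s x₀ and x₀ - v/s, both in Ω.
  have hout : v + (-s) • x₀ ∉ Ω := by
    intro h
    have hz : x₀ - s⁻¹ • v ∈ Ω := by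
      apply hball
      rw [mem_ball_iff_norm, sub_sub_cancel_left, norm_neg, norm_smul, norm_inv,
        Real.norm_of_nonneg hs.le, inv_mul_lt_iff₀ hs]
      linarith
    have := hconv h hz (a := 1 / (1 + s)) (b := s / (1 + s)) (by positivity) (by positivity)
      (by field_simp)
    apply h0n
    convert this using 1
    match_scalars <;> field_simp <;> ring
  by_contra! hne
  have hcont : Continuous fun t : ℝ => v + t • x₀ := by fun_prop
  -- Without a frontier point, Ω and the complement of its closure would disconnect the segment.
  obtain ⟨t, -, ht1, ht2⟩ := (isPreconnected_Icc (a := -s) (b := s))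
    ((fun t : ℝ => v + t • x₀) ⁻¹' Ω) ((fun t : ℝ => v + t • x₀) ⁻¹' (closure Ω)ᶜ)
    (hΩ.preimage hcont) (isClosed_closure.isOpen_compl.preimage hcont)
    (fun t ht => by
      by_cases h : v + t • x₀ ∈ Ω
      · exact Or.inl h
      · refine Or.inr fun h' => hne t (abs_le.2 ht) ?_
        rw [hΩ.frontier_eq]
        exact ⟨h', h⟩)
    ⟨s, ⟨by linarith, le_rfl⟩, hin⟩
    ⟨-s, ⟨le_rfl, by linarith⟩, fun h' => hne (-s) (by simp [abs_of_pos hs]) (by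
      rw [hΩ.frontier_eq]
      exact ⟨h', hout⟩)⟩
  exact ht2 (subset_closure ht1)

/-- The volume of a box with respect to an orthonormal basis. -/
theorem volume_orthonormalBasis_box {n : ℕ}
    (b : OrthonormalBasis (Fin n) ℝ (EuclideanSpace ℝ (Fin n))) (m l : Fin n → ℝ) :
    MeasurableSet {x | ∀ i, |inner ℝ (b i) x - m i| ≤ l i} ∧
    volume {x | ∀ i, |inner ℝ (b i) x - m i| ≤ l i} = ∏ i, ENNReal.ofReal (2 * l i) := by
  have hmp := (PiLp.volume_preserving_ofLp (Fin n)).comp b.measurePreserving_repr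
  have hset : {x | ∀ i, |inner ℝ (b i) x - m i| ≤ l i} =
      (WithLp.ofLp ∘ b.repr) ⁻¹' Set.Icc (fun i => m i - l i) (fun i => m i + l i) := by
    ext x
    simp only [Set.mem_ofPred_eq, Set.mem_preimage, Function.comp_apply, Set.mem_Icc, Pi.le_def,
      b.repr_apply_apply, abs_le, ← forall_and]
    refine forall_congr' fun i => ?_
    constructor <;> rintro ⟨h1, h2⟩ <;> constructor <;> linarith
  rw [hset]
  refine ⟨hmp.measurable measurableSet_Icc, ?_⟩
  rw [hmp.measure_preimage measurableSet_Icc.nullMeasurableSet, Real.volume_Icc_pi]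
  refine Finset.prod_congr rfl fun i _ => ?_
  congr 1
  ring

/-- A subgradient inequality on `Ω` extends to the closure of `Ω` by continuity. -/
theorem subgradients_le_of_mem_closure {n : ℕ} {Ω : Set (EuclideanSpace ℝ (Fin n))}
    {u : EuclideanSpace ℝ (Fin n) → ℝ} (hu : ContinuousOn u (closure Ω))
    {x p y : EuclideanSpace ℝ (Fin n)} (hp : p ∈ subgradients Ω u x) (hy : y ∈ closure Ω) :
    u x + inner ℝ p (y - x) ≤ u y :=
  le_on_closure (f := fun y => u x + inner ℝ p (y - x)) (g := u) hp (by fun_prop) hu hy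

/-- Elementary bound on `p` from its inner products with the points `0`, `x₀` and with the points
`v + θ • x₀` close to every `v` of norm `6 h`, compared with a point `τ • x₀ + w`, `‖w‖ ≤ h`. -/
theorem norm_le_and_abs_inner_le {x₀ w p : E} {τ h ε : ℝ} (hτ1 : 1 / 4 ≤ τ) (hτ2 : τ ≤ 3 / 4)
    (hh : 0 < h) (hε : 0 ≤ ε) (hw : ‖w‖ ≤ h)
    (hp0 : 0 ≤ τ * inner ℝ p x₀ + inner ℝ p w)
    (hp1 : inner ℝ p x₀ ≤ τ * inner ℝ p x₀ + inner ℝ p w)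
    (hpv : ∀ v : E, ‖v‖ ≤ 6 * h → ∃ θ : ℝ, |θ| ≤ 1 / 8 ∧
      inner ℝ p v + θ * inner ℝ p x₀ ≤ τ * inner ℝ p x₀ + inner ℝ p w + ε) :
    ‖p‖ ≤ ε / h ∧ |inner ℝ p x₀| ≤ 4 * ε := by
  set A : ℝ := inner ℝ p x₀
  set B : ℝ := inner ℝ p w with hB_def
  have hB : |B| ≤ ‖p‖ * h :=
    (abs_real_inner_le_norm p w).trans (mul_le_mul_of_nonneg_left hw (norm_nonneg _))
  have hB' := abs_le.1 hB
  -- `hp1` reads (1 - τ)A ≤ B and `hp0` reads -B ≤ τA; both 1 - τ and τ are at least 1/4.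
  have hA1 : A ≤ 4 * (‖p‖ * h) := by
    by_cases hA : 0 ≤ A
    · nlinarith
    · have := mul_nonneg (norm_nonneg p) hh.le
      linarith
  have hA2 : -(4 * (‖p‖ * h)) ≤ A := by
    by_cases hA : 0 ≤ A
    · have := mul_nonneg (norm_nonneg p) hh.le
      linarith
    · nlinarith
  have key : ‖p‖ * h ≤ ε := by
    rcases eq_or_ne p 0 with rfl | hp
    · simpa using hε
    have hpn : 0 < ‖p‖ := norm_pos_iff.2 hp
    -- Test along p itself: 6‖p‖h ≤ (τ - θ)A + B + ε ≤ (7/2 + 1)‖p‖h + ε, so the factor 6 lets the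
    -- left side absorb the right.
    obtain ⟨θ, hθ, hle⟩ := hpv ((6 * h / ‖p‖) • p) (by
      rw [norm_smul, Real.norm_of_nonneg (by positivity), div_mul_cancel₀ _ hpn.ne'])
    rw [inner_smul_right, real_inner_self_eq_norm_sq] at hle
    have he : 6 * h / ‖p‖ * ‖p‖ ^ 2 = 6 * (‖p‖ * h) := by field_simp
    rw [he] at hle
    obtain ⟨hθ1, hθ2⟩ := abs_le.1 hθ
    have h3 : (τ - θ) * A ≤ (τ - θ) * (4 * (‖p‖ * h)) :=
      mul_le_mul_of_nonneg_left hA1 (by linarith)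
    have h4 : (τ - θ) * (4 * (‖p‖ * h)) ≤ (7 / 8) * (4 * (‖p‖ * h)) :=
      mul_le_mul_of_nonneg_right (by linarith) (by positivity)
    nlinarith
  exact ⟨(le_div_iff₀ hh).2 key, abs_le.2 ⟨by linarith, by linarith⟩⟩

/-- Products over `Fin n` of a function that takes one value at `i₀` and another one elsewhere. -/
theorem prod_ite_eq_mul_pow {M : Type*} [CommMonoid M] {n : ℕ} (i₀ : Fin n) (a c : M) :
    ∏ i, (if i = i₀ then a else c) = a * c ^ (n - 1) := by
  rw [Fintype.prod_eq_mul_prod_compl i₀, if_pos rfl]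
  congr 1
  rw [Finset.prod_congr rfl (g := fun _ => c) (fun i hi => if_neg (by simpa using hi)),
    Finset.prod_const, Finset.card_compl, Fintype.card_fin, Finset.card_singleton]

/-- Every nonzero vector is a multiple of a member of an orthonormal basis. -/
theorem exists_orthonormalBasis_norm_smul_eq {n : ℕ} (i₀ : Fin n) {x : EuclideanSpace ℝ (Fin n)}
    (hx : x ≠ 0) :
    ∃ b : OrthonormalBasis (Fin n) ℝ (EuclideanSpace ℝ (Fin n)), ‖x‖ • b i₀ = x := by
  have hx' : ‖x‖ ≠ 0 := norm_ne_zero_iff.2 hx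
  obtain ⟨b, hb⟩ := Orthonormal.exists_orthonormalBasis_extension_of_card_eq (𝕜 := ℝ)
    (E := EuclideanSpace ℝ (Fin n)) (ι := Fin n) (by simp)
    (v := fun _ => ‖x‖⁻¹ • x) (s := {i₀}) (by
      refine ⟨fun i => ?_, fun i j hij => (hij (Subsingleton.elim i j)).elim⟩
      simp [Set.domRestrict, norm_smul, hx'])
  exact ⟨b, by rw [hb i₀ rfl, smul_inv_smul₀ hx']⟩

/-- If `u` vanishes at a point `x₀` of `Ω` and grows at most like `‖x‖ ^ (1 + β)` on the boundary
near `0`, comparing `|∂u(E)|` and `|E|` for a box `E` of width `h` around the middle half of the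
segment `[0, x₀]` gives a bound `h ^ (2 (n - 1)) = O(h ^ (n (1 + β)))`. -/
theorem exists_pow_le_of_eq_zero {n : ℕ} (i₀ : Fin n) {Ω : Set (EuclideanSpace ℝ (Fin n))}
    (hΩ : IsOpen Ω) (hconv : Convex ℝ Ω) (h0 : (0 : EuclideanSpace ℝ (Fin n)) ∈ frontier Ω)
    {lam : ℝ} (hlam : 0 < lam) {u : EuclideanSpace ℝ (Fin n) → ℝ}
    (hu : ContinuousOn u (closure Ω)) (hu_nonneg : ∀ x ∈ Ω, 0 ≤ u x)
    (hMA : ∀ E ⊆ Ω, MeasurableSet E → ENNReal.ofReal lam * volume E ≤ mongeAmpereMeasure Ω u E)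
    {c α : ℝ} (hc : 0 < c) (hα : 0 < α)
    (hgrowth : ∀ᶠ x in 𝓝[frontier Ω] 0, u x ≤ c * ‖x‖ ^ α)
    {x₀ : EuclideanSpace ℝ (Fin n)} (hx₀ : x₀ ∈ Ω) (hux₀ : u x₀ = 0) :
    ∃ K : ℝ, ∀ᶠ h in 𝓝[>] (0 : ℝ), h ^ (2 * (n - 1)) ≤ K * h ^ (n * α) := by
  have h0c : (0 : EuclideanSpace ℝ (Fin n)) ∈ closure Ω := frontier_subset_closure h0
  have hx₀0 : x₀ ≠ 0 := by
    rintro rfl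
    rw [hΩ.frontier_eq] at h0
    exact h0.2 hx₀
  have hn : 0 < n := i₀.pos
  have hnR : (0 : ℝ) < n := by exact_mod_cast hn
  set R := ‖x₀‖ with hR_def
  have hR : 0 < R := norm_pos_iff.2 hx₀0
  have hu0 : u 0 ≤ 0 := by
    have := hgrowth.self_of_nhdsWithin h0
    rwa [norm_zero, Real.zero_rpow hα.ne', mul_zero] at this
  obtain ⟨r, hr, hball⟩ := Metric.isOpen_iff.1 hΩ x₀ hx₀
  obtain ⟨δ, hδ, hδ'⟩ := Metric.mem_nhdsWithin_iff.1 hgrowth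
  obtain ⟨b, hb⟩ := exists_orthonormalBasis_norm_smul_eq i₀ hx₀0
  -- `C * h` bounds the distance to `0` of the boundary points used for boxes of width `h`
  set C := 6 + 12 / r * R with hC_def
  have hC : 0 < C := by positivity
  refine ⟨(c * C ^ α) ^ n * (4 / R) * (4 * n ^ (n - 1) / (lam * R)), ?_⟩
  -- The first bound gives |θ| ≤ 12h/r ≤ 1/8; the second keeps the boundary points where the growth
  -- bound holds.
  have hsmall : ∀ᶠ h in 𝓝[>] (0 : ℝ), h < r / 96 ∧ h < δ / C :=
    (eventually_nhdsWithin_of_eventually_nhds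
      ((eventually_lt_nhds (by positivity)).and (eventually_lt_nhds (by positivity))))
  filter_upwards [hsmall, self_mem_nhdsWithin] with h ⟨hhr, hhδ⟩ hh
  replace hh : 0 < h := hh
  set ε := c * (C * h) ^ α with hε_def
  have hε : 0 < ε := by positivity
  have hbdry : ∀ v : EuclideanSpace ℝ (Fin n), ‖v‖ ≤ 6 * h → ∃ θ : ℝ, |θ| ≤ 1 / 8 ∧
      v + θ • x₀ ∈ frontier Ω ∧ u (v + θ • x₀) ≤ ε := by
    intro v hv
    obtain ⟨θ, hθ, hmem⟩ := exists_add_smul_mem_frontier hΩ hconv h0 hball hr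
      (ρ := 6 * h) (by positivity) (by linarith) hv
    have hnorm : ‖v + θ • x₀‖ ≤ C * h := by
      calc ‖v + θ • x₀‖ ≤ ‖v‖ + |θ| * R := by
            simpa [norm_smul] using norm_add_le v (θ • x₀)
        _ ≤ 6 * h + 2 * (6 * h) / r * R := by gcongr
        _ = C * h := by rw [hC_def]; ring
    refine ⟨θ, hθ.trans ?_, hmem, ?_⟩
    · rw [div_le_iff₀ hr]
      linarith
    · have hlt : C * h < δ := by
        rw [lt_div_iff₀ hC] at hhδ
        linarith
      have := hδ' ⟨mem_ball_zero_iff.2 (hnorm.trans_lt hlt), hmem⟩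
      refine le_trans this ?_
      rw [hε_def]
      gcongr
  -- Transversal half-widths h/n make the transversal part of a point have norm at most h. The bound
  -- |p·x₀| ≤ 4ε becomes 4ε/R because x₀ = R b(i₀).
  set m : Fin n → ℝ := fun i => if i = i₀ then R / 2 else 0
  set l : Fin n → ℝ := fun i => if i = i₀ then R / 4 else h / n with hl_def
  set l' : Fin n → ℝ := fun i => if i = i₀ then 4 * ε / R else ε / h with hl'_def
  have hbox := volume_orthonormalBasis_box b m l
  have hbox' := volume_orthonormalBasis_box b 0 l'
  -- decomposition of the points of the box
  have hdec : ∀ x ∈ {x | ∀ i, |inner ℝ (b i) x - m i| ≤ l i},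
      ∃ (τ : ℝ) (w : EuclideanSpace ℝ (Fin n)),
      1 / 4 ≤ τ ∧ τ ≤ 3 / 4 ∧ ‖w‖ ≤ h ∧ x = τ • x₀ + w := by
    intro x hx
    have hx0 := hx i₀
    simp only [m, l, if_true] at hx0
    obtain ⟨h1, h2⟩ := abs_le.1 hx0
    refine ⟨inner ℝ (b i₀) x / R, x - (inner ℝ (b i₀) x / R) • x₀, ?_, ?_, ?_, by abel⟩
    · rw [le_div_iff₀ hR]; linarith
    · rw [div_le_iff₀ hR]; linarith
    · have hsum : x - (inner ℝ (b i₀) x / R) • x₀ =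
          ∑ i ∈ {i₀}ᶜ, (inner ℝ (b i) x : ℝ) • b i := by
        rw [sub_eq_iff_eq_add', ← hb, smul_smul, div_mul_cancel₀ _ hR.ne',
          ← Fintype.sum_eq_add_sum_compl i₀ (fun i => (inner ℝ (b i) x : ℝ) • b i), b.sum_repr']
      rw [hsum]
      calc ‖∑ i ∈ {i₀}ᶜ, (inner ℝ (b i) x : ℝ) • b i‖
          ≤ ∑ i ∈ ({i₀}ᶜ : Finset (Fin n)), h / n := by
            refine norm_sum_le_of_le _ fun i hi => ?_
            have hi' : i ≠ i₀ := by simpa using hi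
            have := hx i
            simp only [m, l, if_neg hi', sub_zero] at this
            simpa [norm_smul] using this
        _ ≤ ∑ i : Fin n, h / n :=
            Finset.sum_le_sum_of_subset_of_nonneg (Finset.subset_univ _)
              fun _ _ _ => by positivity
        _ = h := by
            rw [Finset.sum_const, Finset.card_univ, Fintype.card_fin, nsmul_eq_mul]
            field_simp
  have hsub : {x | ∀ i, |inner ℝ (b i) x - m i| ≤ l i} ⊆ Ω := by
    intro x hx
    obtain ⟨τ, w, hτ1, hτ2, hw, rfl⟩ := hdec x hx
    exact smul_add_mem_of_ball_subset hΩ hconv h0c hball (by linarith) (by linarith)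
      (by nlinarith)
  have himg : (⋃ x ∈ {x | ∀ i, |inner ℝ (b i) x - m i| ≤ l i}, subgradients Ω u x) ⊆
      {p | ∀ i, |inner ℝ (b i) p - (0 : Fin n → ℝ) i| ≤ l' i} := by
    refine Set.iUnion₂_subset fun x hx p hp => ?_
    have hux : 0 ≤ u x := hu_nonneg x (hsub hx)
    obtain ⟨τ, w, hτ1, hτ2, hw, rfl⟩ := hdec x hx
    have hle : ∀ y ∈ closure Ω, (inner ℝ p y : ℝ) ≤
        τ * inner ℝ p x₀ + inner ℝ p w + u y := by
      intro y hy
      have := subgradients_le_of_mem_closure hu hp hy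
      rw [inner_sub_right, inner_add_right, inner_smul_right] at this
      linarith
    obtain ⟨hp1, hp2⟩ := norm_le_and_abs_inner_le (x₀ := x₀) (w := w) (p := p) hτ1 hτ2 hh hε.le hw
      (by
        have := hle 0 h0c
        rw [inner_zero_right] at this
        linarith)
      (by
        have := hle x₀ (subset_closure hx₀)
        linarith)
      (fun v hv => by
        obtain ⟨θ, hθ, hmem, huθ⟩ := hbdry v hv
        refine ⟨θ, hθ, ?_⟩
        have := hle _ (frontier_subset_closure hmem)
        rw [inner_add_right, inner_smul_right] at this
        linarith)
    intro i
    rw [Pi.zero_apply, sub_zero]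
    by_cases hi : i = i₀
    · subst hi
      simp only [hl'_def, if_true]
      rw [← hb, inner_smul_right, abs_mul, abs_of_pos hR, real_inner_comm] at hp2
      rw [le_div_iff₀ hR]
      linarith
    · simp only [hl'_def, if_neg hi]
      refine (abs_real_inner_le_norm _ _).trans ?_
      simpa using hp1
  have hvol := (hMA _ hsub hbox.1).trans (measure_mono himg)
  rw [hbox.2, hbox'.2, ← ENNReal.ofReal_prod_of_nonneg, ← ENNReal.ofReal_prod_of_nonneg,
    ← ENNReal.ofReal_mul hlam.le, ENNReal.ofReal_le_ofReal_iff, Finset.prod_mul_distrib,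
    Finset.prod_mul_distrib, prod_ite_eq_mul_pow, prod_ite_eq_mul_pow] at hvol
  rotate_left
  · refine Finset.prod_nonneg fun i _ => ?_
    simp only [hl'_def]
    split_ifs <;> positivity
  · intro i _
    simp only [hl'_def]
    split_ifs <;> positivity
  · intro i _
    simp only [hl_def]
    split_ifs <;> positivity
  have h2 : (0 : ℝ) < ∏ _i : Fin n, (2 : ℝ) := Finset.prod_pos fun _ _ => two_pos
  have hvol' : lam * (R / 4 * (h / n) ^ (n - 1)) ≤ 4 * ε / R * (ε / h) ^ (n - 1) := by
    refine le_of_mul_le_mul_left ?_ h2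
    linarith
  have hεn : ε ^ n = (c * C ^ α) ^ n * h ^ (n * α) := by
    rw [hε_def, Real.mul_rpow hC.le hh.le, ← mul_assoc, mul_pow, mul_comm (n : ℝ) α,
      Real.rpow_mul hh.le, Real.rpow_natCast]
  have hεs : ε * ε ^ (n - 1) = ε ^ n := by
    rw [← pow_succ', Nat.sub_add_cancel hn]
  have hpos : 0 < h ^ (n - 1) := by positivity
  -- Multiplying by h^(n-1) clears the denominator of (ε/h)^(n-1), leaving εⁿ.
  calc h ^ (2 * (n - 1))
      = (lam * (R / 4 * (h / n) ^ (n - 1))) * (h ^ (n - 1) * (4 * n ^ (n - 1) / (lam * R))) := by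
        rw [div_pow, two_mul, pow_add]
        field_simp
    _ ≤ (4 * ε / R * (ε / h) ^ (n - 1)) * (h ^ (n - 1) * (4 * n ^ (n - 1) / (lam * R))) := by
        gcongr
    _ = (ε * ε ^ (n - 1)) * (4 / R) * (4 * n ^ (n - 1) / (lam * R)) := by
        rw [div_pow]
        field_simp
    _ = _ := by
        rw [hεs, hεn]
        ring

/-- A bound `h ^ k ≤ K * h ^ a` for small `h > 0` forces `a ≤ k`. -/
theorem le_of_eventually_pow_le {k : ℕ} {a K : ℝ}
    (h : ∀ᶠ t in 𝓝[>] (0 : ℝ), t ^ k ≤ K * t ^ a) : a ≤ k := by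
  by_contra! hlt
  -- Dividing the bound by t^k gives 1 ≤ K t^(a-k), whose right side tends to 0 if a > k.
  have hlim : Filter.Tendsto (fun t : ℝ => K * t ^ (a - k)) (𝓝[>] 0) (𝓝 0) := by
    have h1 : Filter.Tendsto (fun t : ℝ => t ^ (a - k)) (𝓝 0) (𝓝 0) := by
      have := (Real.continuousAt_rpow_const 0 (a - k) (Or.inr (by linarith))).tendsto
      rwa [Real.zero_rpow (by linarith)] at this
    simpa using (h1.mono_left nhdsWithin_le_nhds).const_mul K
  obtain ⟨t, h1, h2, ht⟩ :=
    (h.and ((hlim.eventually_lt_const one_pos).and self_mem_nhdsWithin)).exists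
  replace ht : 0 < t := ht
  rw [Real.rpow_sub ht, Real.rpow_natCast, ← mul_div_assoc, div_lt_one (by positivity)] at h2
  linarith

end MongeAmpere

theorem lemma3p1 {n : ℕ} (Ω : Set (EuclideanSpace ℝ (Fin n)))
    (hΩ_open : IsOpen Ω) (hΩ_bdd : Bornology.IsBounded Ω) (hΩ_conv : Convex ℝ Ω)
    (h0 : (0 : EuclideanSpace ℝ (Fin n)) ∈ frontier Ω)
    (lam : ℝ) (hlam : 0 < lam)
    (φ : EuclideanSpace ℝ (Fin n) → ℝ) (hφ_cont : ContinuousOn φ (frontier Ω))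
    (hφ_nonneg : ∀ x ∈ frontier Ω, 0 ≤ φ x)
    (u : EuclideanSpace ℝ (Fin n) → ℝ) (hu_cont : ContinuousOn u (closure Ω))
    (hu_nonneg : ∀ x ∈ Ω, 0 ≤ u x)
    (hu_sol : MongeAmpere.IsGeneralizedSolutionGE Ω lam u)
    (hu_bdry : ∀ x ∈ frontier Ω, u x = φ x)
    (c β : ℝ) (hc : 0 < c) (hβ : 1 - 2 / (n : ℝ) < β)
    (hφ_growth : ∀ᶠ x in 𝓝[frontier Ω] 0, φ x ≤ c * ‖x‖ ^ (1 + β)) :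
    ∀ x ∈ Ω, 0 < u x := by
  intro x₀ hx₀
  refine lt_of_le_of_ne (hu_nonneg x₀ hx₀) fun hzero => ?_
  obtain rfl | hn := n.eq_zero_or_pos
  · rw [Subsingleton.elim x₀ 0] at hx₀
    rw [hΩ_open.frontier_eq] at h0
    exact h0.2 hx₀
  have hn1 : (1 : ℝ) ≤ n := by exact_mod_cast hn
  -- This is β > 1 - 2/n multiplied by n; as n ≥ 1 it also forces 1 + β > 0.
  have hexp : 2 * ((n : ℝ) - 1) < n * (1 + β) := by
    have h1 : (n : ℝ) * (1 - 2 / n) < n * β := mul_lt_mul_of_pos_left hβ (by linarith)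
    have h2 : (n : ℝ) * (1 - 2 / n) = n - 2 := by field_simp
    linarith
  have hα : 0 < 1 + β := by
    by_contra! hneg
    nlinarith
  have hgrowth : ∀ᶠ x in 𝓝[frontier Ω] 0, u x ≤ c * ‖x‖ ^ (1 + β) := by
    filter_upwards [hφ_growth, self_mem_nhdsWithin] with x hx hxm
    rwa [hu_bdry x hxm]
  obtain ⟨K, hK⟩ := MongeAmpere.exists_pow_le_of_eq_zero ⟨0, hn⟩ hΩ_open hΩ_conv h0 hlam hu_cont
    hu_nonneg hu_sol.2 hc hα hgrowth hx₀ hzero.symm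
  have hle := MongeAmpere.le_of_eventually_pow_le hK
  push_cast [Nat.cast_sub hn] at hle
  linarith
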